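/- Write $\mathbb T=\mathbb R/\mathbb Z$; for $t\in\mathbb T$ let $|t|\in[0,1/2]$ be its distance to $0$. All groups are abelian topological groups; the Pontryagin dual $\widehat G$ is the group of continuous characters $G\to\mathbb T$ with the compact-open topology. A set $A\subseteq G$ is quasi-convex if for every $g\notin A$ there is $\chi\in\widehat G$ with $|\chi(a)|\le 1/4$ for all $a\in A$ and $|\chi(g)|>1/4$; let $\mathcal Q$ be the category of Hausdorff groups with a neighbourhood base at $0$ of quasi-convex sets. A continuous bihomomorphism is a map $b\colon G\times H\to A$ that is a continuous homomorphism in each variable and is continuous at $(0,0)$. The locally quasi-convex tensor product $(G\otimes_{\mathcal Q}H,\otimes_{\mathcal Q})$ is the (unique up to topological isomorphism) group in $\mathcal Q$ with a continuous bihomomorphism $\otimes_{\mathcal Q}\colon G\times H\to G\otimes_{\mathcal Q}H$ through which every continuous bihomomorphism of $G\times H$ into a group $B\in\mathcal Q$ factors by a continuous homomorphism $G\otimes_{\mathcal Q}H\to B$, and such that two homomorphisms on $G\otimes_{\mathcal Q}H$ into the same group agree if they agree on the image of $\otimes_{\mathcal Q}$. **Theorem.** Let $I$ be a set of non-measurable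 cardinality, that is, every countably complete ultrafilter on $I$ is principal. Let $\mathbb Z^I$ carry the product topology of discrete groups, and let $H=\operatorname{Hom}(\mathbb Z^I,\mathbb Z)$ (all group homomorphisms) carry the topology of pointwise convergence on $\mathbb Z^I$, inherited from $\mathbb Z^{\mathbb Z^I}$. Then the pairing $\langle g,x\rangle=\sum_{i\in I} g(i)x(i)$ identifies $\mathbb Z^{(I)}$ with $H$, the tensor product $\mathbb Z^I\otimes_{\mathcal Q}\mathbb T$ exists, and there is a topological isomorphism $$\widehat H\cong \mathbb Z^I\otimes_{\mathcal Q}\mathbb T$$ under which $x\otimes_{\mathcal Q}t$ corresponds to the character $g\mapsto g(x)\,t$ of $H$. In particular, all of this holds for $I=\mathbb N$. -/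

import Mathlib

open scoped TensorProduct Topology

universe u v w

/-- The circle group `𝕋 = ℝ / ℤ`, written additively; `‖t‖` is the distance of `t` to `0`, that is,
`|t|` for the representative `t ∈ (-1/2, 1/2]`. -/
abbrev Torus : Type := UnitAddCircle

/-- The Pontryagin dual of `G`: all continuous characters `G → 𝕋`, with the compact-open
topology (Mathlib's topology on continuous homomorphisms). -/
abbrev CharGroup (G : Type u) [AddCommGroup G] [TopologicalSpace G] : Type u :=
  G →ₜ+ Torus

section QuasiConvex

variable {G : Type u} [AddCommGroup G] [TopologicalSpace G]

/-- The polar of a subset of `G`. -/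
def polar (A : Set G) : Set (CharGroup G) := {χ | ∀ a ∈ A, ‖χ a‖ ≤ 1 / 4}

/-- The inverse polar of a set of characters of `G`. -/
def prepolar (X : Set (CharGroup G)) : Set G := {g | ∀ χ ∈ X, ‖χ g‖ ≤ 1 / 4}

/-- A set is quasi-convex if it equals its bipolar in `G`. -/
def QuasiConvex (A : Set G) : Prop := prepolar (polar A) = A

end QuasiConvex

/-- `G` has a neighbourhood base at `0` consisting of quasi-convex sets. -/
def LocallyQuasiConvex (G : Type u) [AddCommGroup G] [TopologicalSpace G] : Prop :=
  ∀ U ∈ 𝓝 (0 : G), ∃ V ∈ 𝓝 (0 : G), QuasiConvex V ∧ V ⊆ U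

/-- The class of Hausdorff locally quasi-convex abelian topological groups. -/
structure IsLQGroup (G : Type u) [AddCommGroup G] [TopologicalSpace G] : Prop where
  topologicalGroup : IsTopologicalAddGroup G
  hausdorff : T2Space G
  locallyQuasiConvex : LocallyQuasiConvex G

/-- Continuous bihomomorphisms `G × H → A`: continuous homomorphisms in each variable, and
continuous at `(0, 0)`. -/
structure IsContBihom {G : Type u} {H : Type v} {A : Type w}
    [AddCommGroup G] [TopologicalSpace G] [AddCommGroup H] [TopologicalSpace H]
    [AddCommGroup A] [TopologicalSpace A] (b : G → H → A) : Prop where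
  map_add_left : ∀ x x' y, b (x + x') y = b x y + b x' y
  map_add_right : ∀ x y y', b x (y + y') = b x y + b x y'
  continuous_left : ∀ y, Continuous fun x => b x y
  continuous_right : ∀ x, Continuous fun y => b x y
  continuousAt_zero : ContinuousAt (fun p : G × H => b p.1 p.2) (0, 0)

/-- `(T, τ)` is the tensor product of `G` and `H` in the category of Hausdorff locally quasi-convex
groups: `τ` is a continuous bihomomorphism into a group of that category, every continuous
bihomomorphism into such a group factors through `τ` by a continuous homomorphism, and `τ` is an
epi-bihomomorphism (which makes the factorization and, up to a topological isomorphism, `T`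
unique). -/
structure IsLQTensorProduct {G : Type*} {H : Type*} {T : Type*}
    [AddCommGroup G] [TopologicalSpace G] [AddCommGroup H] [TopologicalSpace H]
    [AddCommGroup T] [TopologicalSpace T] (τ : G → H → T) : Prop where
  isLQGroup : IsLQGroup T
  isContBihom : IsContBihom τ
  exists_lift : ∀ (B : Type w) [AddCommGroup B] [TopologicalSpace B], IsLQGroup B →
    ∀ b : G → H → B, IsContBihom b → ∃ f : T →ₜ+ B, ∀ x y, f (τ x y) = b x y
  epi : ∀ (B : Type w) [AddCommGroup B] (h₁ h₂ : T →+ B),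
    (∀ x y, h₁ (τ x y) = h₂ (τ x y)) → h₁ = h₂

section Tensor

variable (G : Type u) (H : Type v) [AddCommGroup G] [TopologicalSpace G]
  [AddCommGroup H] [TopologicalSpace H]

/-- The locally quasi-convex group topologies on the algebraic tensor product `G ⊗ H` for which
`(x, y) ↦ x ⊗ y` is a continuous bihomomorphism. -/
def admissibleTopologies : Set (TopologicalSpace (G ⊗[ℤ] H)) :=
  {t | @IsTopologicalAddGroup (G ⊗[ℤ] H) t _ ∧ @LocallyQuasiConvex (G ⊗[ℤ] H) _ t ∧
    @IsContBihom G H (G ⊗[ℤ] H) _ _ _ _ _ t (fun x y => x ⊗ₜ[ℤ] y)}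

/-- The algebraic tensor product `G ⊗ H`, carrying the finest admissible topology. -/
def PreLQTensor : Type (max u v) := G ⊗[ℤ] H

noncomputable instance : AddCommGroup (PreLQTensor G H) :=
  inferInstanceAs (AddCommGroup (G ⊗[ℤ] H))

/-- The supremum, as a coarsest common refinement, of all admissible topologies; in Mathlib's
order of topologies, where finer means smaller, it is an infimum. -/
instance : TopologicalSpace (PreLQTensor G H) := sInf (admissibleTopologies G H)

instance : IsTopologicalAddGroup (PreLQTensor G H) :=
  topologicalAddGroup_sInf fun _ ht => ht.1

/-- The locally quasi-convex tensor product: the Hausdorff quotient of `G ⊗ H`. -/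
def LQTensor : Type (max u v) := SeparationQuotient (PreLQTensor G H)

noncomputable instance : AddCommGroup (LQTensor G H) :=
  inferInstanceAs (AddCommGroup (SeparationQuotient (PreLQTensor G H)))

instance : TopologicalSpace (LQTensor G H) :=
  inferInstanceAs (TopologicalSpace (SeparationQuotient (PreLQTensor G H)))

instance : IsTopologicalAddGroup (LQTensor G H) :=
  inferInstanceAs (IsTopologicalAddGroup (SeparationQuotient (PreLQTensor G H)))

variable {G H}

/-- The canonical map `G × H → LQTensor G H`. -/
def LQTensor.tmul (x : G) (y : H) : LQTensor G H :=
  SeparationQuotient.mk (show PreLQTensor G H from x ⊗ₜ[ℤ] y)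

end Tensor

/-- The group `Hom(A, ℤ)` of all homomorphisms, with the topology of pointwise convergence
on `A`. -/
def ZDual (A : Type u) [AddCommGroup A] : Type u := A →+ ℤ

section ZDual

variable (A : Type u) [AddCommGroup A]

instance : AddCommGroup (ZDual A) := inferInstanceAs (AddCommGroup (A →+ ℤ))

instance : FunLike (ZDual A) A ℤ := inferInstanceAs (FunLike (A →+ ℤ) A ℤ)

/-- The topology inherited from the product `ℤ ^ A` of discrete groups. -/
instance : TopologicalSpace (ZDual A) :=
  TopologicalSpace.induced (fun g : ZDual A => (g : A → ℤ)) inferInstance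

end ZDual

/-- `I` has non-measurable cardinality: every countably complete ultrafilter on `I` is principal
(equivalently, no countably additive `{0, 1}`-valued measure on all subsets of `I`
that vanishes on singletons has total mass `1`). -/
def NonMeasurableCardinality (I : Type u) : Prop :=
  ∀ U : Ultrafilter I, CountableInterFilter (U : Filter I) → ∃ i : I, U = pure i

/-! Everything rests on `charTensor`, the homomorphism taking x ⊗ t to the character g ↦ g(x)t. It
is onto: a character of H is small on a subgroup fixed by finitely many vanishing values, hence
trivial there, and extends from a subgroup of a finite power of ℤ because 𝕋 is divisible
(`charTensor_surjective`). Compact subsets of H are finite, by a gliding hump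
(`finite_iUnion_support_of_bounded`), so the compact-open topology on the dual is pointwise
convergence.

It remains to see that pointwise convergence on H is the finest admissible topology on ℤ^I ⊗ 𝕋. It
is admissible because every g has finite support, by Specker's theorem and its extension to
non-measurable I. It is finest because, for quasi-convex V, all characters in the polar of V kill
b(x, t) once x vanishes on one fixed finite set of coordinates
(`IsContBihom.exists_finset_of_mem_nhds_zero`). The Hausdorff quotient removes the kernel of
`charTensor`, so that kernel need not be computed. -/

/-! ### Specker's theorem on homomorphisms ℤ^ℕ → ℤ -/

section Specker

/-- For a partition of `I` indexed by `p : I → ℕ` and `x : ℤ ^ I`, the homomorphism that sends a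
sequence `a` to the function which is `a n • x` on the `n`-th block. -/
def blockHom {I : Type u} (p : I → ℕ) (x : I → ℤ) : (ℕ → ℤ) →+ (I → ℤ) where
  toFun a i := a (p i) * x i
  map_zero' := by ext; simp
  map_add' a b := by ext; simp [add_mul]

@[simp]
lemma blockHom_apply {I : Type u} (p : I → ℕ) (x : I → ℤ) (a : ℕ → ℤ) (i : I) :
    blockHom p x a i = a (p i) * x i := rfl

lemma map_eq_sum_of_support_subset {I : Type u} [DecidableEq I] (f : (I → ℤ) →+ ℤ)
    (s : Finset I) (x : I → ℤ) (hx : ∀ i ∉ s, x i = 0) :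
    f x = ∑ i ∈ s, x i * f (Pi.single i 1) := by
  have h : x = ∑ i ∈ s, x i • (Pi.single i 1 : I → ℤ) := by
    ext j
    simp only [Finset.sum_apply, Pi.smul_apply, smul_eq_mul, Pi.single_apply, mul_ite, mul_one,
      mul_zero, Finset.sum_ite_eq]
    split_ifs with hj
    · rfl
    · exact hx j hj
  conv_lhs => rw [h]
  simp only [map_sum, map_zsmul, smul_eq_mul]

lemma dvd_map_of_forall_dvd {I : Type u} (f : (I → ℤ) →+ ℤ) (d : ℤ) (x : I → ℤ)
    (hx : ∀ i, d ∣ x i) : d ∣ f x := by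
  choose y hy using hx
  have : x = d • y := by ext i; simp [hy]
  rw [this, map_zsmul]
  exact Dvd.intro _ rfl

lemma eq_zero_of_forall_pow_dvd {d m : ℤ} (hd : 1 < d) (h : ∀ n : ℕ, d ^ n ∣ m) : m = 0 := by
  by_contra hm
  have h1 := Int.le_of_dvd (abs_pos.2 hm) ((dvd_abs _ _).2 (h m.natAbs))
  have h2 : m.natAbs < d.toNat ^ m.natAbs := Nat.lt_pow_self (by omega)
  have h3 : ((d.toNat ^ m.natAbs : ℕ) : ℤ) = d ^ m.natAbs := by
    rw [Nat.cast_pow, Int.toNat_of_nonneg (by omega)]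
  have h4 : (m.natAbs : ℤ) = |m| := Int.natCast_natAbs m
  omega

/-- Deleting the first n entries does not change the value of f and leaves a sequence divisible by d
^ n, so the value is divisible by every power of d. -/
lemma map_geometric_eq_zero (f : (ℕ → ℤ) →+ ℤ) (hf : ∀ n, f (Pi.single n 1) = 0) {d : ℤ}
    (hd : 1 < d) (a : ℕ → ℤ) : f (fun n => d ^ n * a n) = 0 := by
  refine eq_zero_of_forall_pow_dvd hd fun n => ?_
  set x : ℕ → ℤ := fun n => d ^ n * a n
  let y : ℕ → ℤ := fun k => if k < n then x k else 0
  have hy : f y = 0 := by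
    rw [map_eq_sum_of_support_subset f (Finset.range n) y (fun i hi => by simp_all [y])]
    simp [hf]
  have : f x = f (x - y) := by rw [map_sub, hy, sub_zero]
  rw [this]
  refine dvd_map_of_forall_dvd f _ _ fun i => ?_
  by_cases hi : i < n
  · simp [y, hi]
  · simp only [Pi.sub_apply, y, hi, if_false, sub_zero, x]
    exact Dvd.dvd.mul_right (pow_dvd_pow d (not_lt.1 hi)) _

/-- A homomorphism `ℤ ^ ℕ → ℤ` vanishing on all unit vectors is zero. -/
theorem eq_zero_of_map_single_eq_zero (f : (ℕ → ℤ) →+ ℤ) (hf : ∀ n, f (Pi.single n 1) = 0) :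
    f = 0 := by
  ext x
  -- Coprimality splits any sequence into one divisible by 2 ^ n and one divisible by 3 ^ n in place
  -- n.
  have h : ∀ n : ℕ, ∃ u v : ℤ, (2 : ℤ) ^ n * u + 3 ^ n * v = x n := fun n => by
    have hc : IsCoprime ((2 : ℤ) ^ n) (3 ^ n) := IsCoprime.pow ⟨-1, 1, by norm_num⟩
    obtain ⟨u, v, h⟩ := hc
    exact ⟨x n * u, x n * v, by linear_combination x n * h⟩
  choose u v h using h
  have : x = (fun n => (2 : ℤ) ^ n * u n) + fun n => (3 : ℤ) ^ n * v n := by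
    ext n; simp [h]
  rw [this, map_add, map_geometric_eq_zero f hf (by norm_num), map_geometric_eq_zero f hf (by norm_num)]
  simp

/-- A cardinality argument: otherwise suitable weights `d` make f injective on the sequences d ·
1_s, embedding the subsets of ℕ into ℤ. At the first place m where two sets differ, equal values
would force |f(e_m)| + 1 to divide f(e_m) ≠ 0. -/
lemma exists_map_single_eq_zero (f : (ℕ → ℤ) →+ ℤ) : ∃ n, f (Pi.single n 1) = 0 := by
  by_contra! hf
  let d : ℕ → ℤ := fun n => ∏ k ∈ Finset.range n, (|f (Pi.single k 1)| + 1)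
  have hd : ∀ n, d n ≠ 0 := fun n => Finset.prod_ne_zero_iff.2 fun k _ => by positivity
  have hdvd : ∀ {m n}, m ≤ n → d m ∣ d n := fun h =>
    Finset.prod_dvd_prod_of_subset _ _ _ (by simpa using h)
  classical
  let F : Set ℕ → ℤ := fun s => f fun n => if n ∈ s then d n else 0
  have hF : Function.Injective F := by
    intro s t hst
    by_contra hne
    have hex : ∃ m, ¬ (m ∈ s ↔ m ∈ t) := by
      by_contra! h; exact hne (Set.ext h)
    set m := Nat.find hex
    have hm : ¬ (m ∈ s ↔ m ∈ t) := Nat.find_spec hex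
    have hlt : ∀ k < m, (k ∈ s ↔ k ∈ t) := fun k hk => not_not.1 (Nat.find_min hex hk)
    let z : ℕ → ℤ := (fun n => if n ∈ s then d n else 0) - fun n => if n ∈ t then d n else 0
    have hz : f z = 0 := by
      have : F s - F t = 0 := sub_eq_zero.2 hst
      rw [← this, ← map_sub]
    have h1 : d (m + 1) ∣ f (z - z m • Pi.single m 1) := by
      refine dvd_map_of_forall_dvd f _ _ fun i => ?_
      rcases lt_trichotomy i m with h | h | h
      · simp [z, hlt i h, h.ne]
      · simp [h]
      · have := hdvd (Nat.succ_le_of_lt h)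
        simp only [Pi.sub_apply, Pi.smul_apply, Pi.single_apply, h.ne', if_false, smul_zero, sub_zero,
          z]
        split_ifs <;> simp [this]
    rw [map_sub, hz, zero_sub, dvd_neg, map_zsmul, smul_eq_mul] at h1
    have hzm : z m = d m ∨ z m = - d m := by
      by_cases h : m ∈ s <;> by_cases h' : m ∈ t <;> simp_all [z]
    have h2 : d m * (|f (Pi.single m 1)| + 1) ∣ d m * f (Pi.single m 1) := by
      rw [show d (m + 1) = d m * (|f (Pi.single m 1)| + 1) from Finset.prod_range_succ _ _] at h1
      rcases hzm with h | h <;> rw [h] at h1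
      · exact h1
      · simpa using h1
    have h3 := (mul_dvd_mul_iff_left (hd m)).1 h2
    have h4 := Int.le_of_dvd (abs_pos.2 (hf m)) ((dvd_abs _ _).2 h3)
    omega
  exact Function.cantor_injective (f := fun s => (Denumerable.eqv ℤ) (F s))
    ((Denumerable.eqv ℤ).injective.comp hF)

/-- A homomorphism `ℤ ^ I → ℤ` is nonzero on finitely many unit vectors only. -/
theorem finite_setOf_map_single_ne_zero {I : Type u} [DecidableEq I] (f : (I → ℤ) →+ ℤ) :
    {i | f (Pi.single i 1) ≠ 0}.Finite := by
  by_contra hinf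
  let e := Set.Infinite.natEmbedding _ hinf
  let j : ℕ → I := fun n => e n
  have hj : Function.Injective j := Subtype.val_injective.comp e.injective
  classical
  -- The cutoff kills the indices outside the range of `j`, where `invFun` has an arbitrary value.
  let x : I → ℤ := fun i => if i ∈ Set.range j then 1 else 0
  obtain ⟨n, hn⟩ := exists_map_single_eq_zero (f.comp (blockHom (Function.invFun j) x))
  refine (e n).2 (Eq.trans ?_ hn)
  rw [AddMonoidHom.comp_apply]
  congr 1
  ext i
  by_cases hi : ∃ k, j k = i
  · obtain ⟨k, rfl⟩ := hi
    simp [x, Function.leftInverse_invFun hj k, Pi.single_apply, show (e n : I) = j n from rfl,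
      hj.eq_iff]
  · have : i ≠ (e n : I) := fun h => hi ⟨n, h.symm⟩
    simp [x, hi, Pi.single_apply, this]

end Specker

/-! ### Null sets and non-measurable index sets -/

section NullSet

variable {I : Type u}

/-- A set `S ⊆ I` is null for `f : ℤ ^ I → ℤ` if `f` vanishes on all functions supported in `S`. -/
def NullSet (f : (I → ℤ) →+ ℤ) (S : Set I) : Prop := ∀ x : I → ℤ, (∀ i ∉ S, x i = 0) → f x = 0

variable {f : (I → ℤ) →+ ℤ}

lemma NullSet.mono {S T : Set I} (hT : NullSet f T) (h : S ⊆ T) : NullSet f S :=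
  fun x hx => hT x fun i hi => hx i fun hS => hi (h hS)

/-- Cut x into countably many blocks, one inside each S n. The induced homomorphism on ℤ^ℕ kills
unit vectors, hence vanishes, in particular at the constant sequence 1. -/
lemma NullSet.iUnion {S : ℕ → Set I} (hS : ∀ n, NullSet f (S n)) : NullSet f (⋃ n, S n) := by
  classical
  intro x hx
  let p : I → ℕ := fun i => if h : ∃ n, i ∈ S n then h.choose else 0
  have h0 : f.comp (blockHom p x) = 0 := by
    refine eq_zero_of_map_single_eq_zero _ fun n => hS n _ fun i hi => ?_
    by_cases h : ∃ n, i ∈ S n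
    · have hp : i ∈ S (p i) := by simpa [p, h] using h.choose_spec
      have : p i ≠ n := by rintro rfl; exact hi hp
      simp [this]
    · simp [hx i (by simpa using h)]
  have h1 : blockHom p x 1 = x := by ext; simp
  rw [← h1]
  exact DFunLike.congr_fun h0 1

lemma NullSet.union {S T : Set I} (hS : NullSet f S) (hT : NullSet f T) : NullSet f (S ∪ T) := by
  refine (NullSet.iUnion (S := fun n => if n = 0 then S else T) fun n => ?_).mono ?_
  · split_ifs <;> assumption
  · exact Set.union_subset (Set.subset_iUnion_of_subset 0 (by simp))
      (Set.subset_iUnion_of_subset 1 (by simp))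

/-- Otherwise, gluing witnesses from the S n gives a homomorphism on ℤ^ℕ that is nonzero on every
unit vector. -/
lemma exists_nullSet_of_pairwise_disjoint {S : ℕ → Set I} (hS : Pairwise (Function.onFun Disjoint S)) :
    ∃ n, NullSet f (S n) := by
  classical
  by_contra! h
  simp only [NullSet, not_forall] at h
  choose x hx hfx using h
  let p : I → ℕ := fun i => if h : ∃ n, i ∈ S n then h.choose else 0
  have hp : ∀ {i n}, i ∈ S n → p i = n := fun {i n} hi => by
    have h : ∃ n, i ∈ S n := ⟨n, hi⟩
    have hpi : i ∈ S (p i) := by simpa [p, h] using h.choose_spec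
    by_contra hne
    exact Set.disjoint_left.1 (hS hne) hpi hi
  let y : I → ℤ := fun i => x (p i) i
  obtain ⟨n, hn⟩ := exists_map_single_eq_zero (f.comp (blockHom p y))
  refine hfx n ?_
  rw [← hn, AddMonoidHom.comp_apply]
  congr 1
  ext i
  by_cases hpi : p i = n
  · simp [y, hpi]
  · simp [hpi, hx n i fun h => hpi (hp h)]

/-- If the whole index set is not null, then there is a set which is not null and has no partition
into two sets that are not null. -/
lemma exists_nullSet_atom (hf : ¬ NullSet f Set.univ) :
    ∃ S, ¬ NullSet f S ∧ ∀ T ⊆ S, NullSet f T ∨ NullSet f (S \ T) := by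
  by_contra! h
  choose! T hTS hT hST using h
  -- Without an atom, repeated splitting gives a decreasing sequence whose successive differences
  -- are disjoint and not null.
  let A : ℕ → Set I := fun n => T^[n] Set.univ
  have hA : ∀ n, ¬ NullSet f (A n) := by
    intro n
    induction n with
    | zero => exact hf
    | succ n ih =>
      simp only [A, Function.iterate_succ_apply']
      exact hT _ ih
  have hsucc : ∀ n, A (n + 1) = T (A n) := fun n => Function.iterate_succ_apply' T n _
  have hanti : Antitone A := antitone_nat_of_succ_le fun n => by
    rw [hsucc]; exact hTS _ (hA n)
  obtain ⟨n, hn⟩ := exists_nullSet_of_pairwise_disjoint (f := f) (S := fun n => A n \ A (n + 1)) (by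
    refine (pairwise_disjoint_on _).2 fun m n hmn => ?_
    exact Set.disjoint_left.2 fun i hi hi' => hi.2 (hanti (Nat.succ_le_of_lt hmn) hi'.1))
  refine hST _ (hA n) ?_
  rw [← hsucc]
  exact hn

/-- For `I` of non-measurable cardinality, a homomorphism `ℤ ^ I → ℤ` vanishing on all unit vectors
is zero. -/
theorem NonMeasurableCardinality.eq_zero_of_map_single_eq_zero [DecidableEq I]
    (hI : NonMeasurableCardinality I) (hf : ∀ i, f (Pi.single i 1) = 0) : f = 0 := by
  by_contra hne
  obtain ⟨S, hS, hatom⟩ := exists_nullSet_atom (f := f) fun h => hne (by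
    ext x; exact h x (by simp))
  -- Sets conull in the atom form a countably complete ultrafilter. If it were principal at i, both
  -- S \ {i} and {i} would be null, contradicting the choice of S.
  let l : Filter I := Filter.ofCountableInter {T | NullSet f (S \ T)} (by
    intro 𝒯 hc h
    rcases 𝒯.eq_empty_or_nonempty with rfl | hne
    · intro x hx
      have : x = 0 := by ext i; exact hx i (by simp)
      simp [this]
    obtain ⟨t, rfl⟩ := hc.exists_eq_range hne
    refine (NullSet.iUnion fun n => h ⟨n, rfl⟩).mono fun i => ?_
    simp) (fun s t hs hst => NullSet.mono hs (Set.sdiff_subset_sdiff_right hst))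
  have hl : ∀ T, T ∈ l ↔ NullSet f (S \ T) := fun T => Iff.rfl
  let U : Ultrafilter I := Ultrafilter.ofComplNotMemIff l fun T => by
    rw [hl, hl]
    constructor
    · intro h
      rcases hatom (S \ T) Set.sdiff_subset with h' | h'
      · exact h'
      · refine absurd (h'.mono fun i => ?_) h
        simp +contextual
    · intro h h'
      refine hS ((h.union h').mono fun i hi => ?_)
      by_cases i ∈ T <;> simp_all
  obtain ⟨i, hi⟩ := hI U (show CountableInterFilter l from inferInstance)
  have hmem : {i} ∈ l := by
    change {i} ∈ U
    rw [hi]; simp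
  refine hS (((hl _).1 hmem |>.union (T := {i}) fun x hx => ?_).mono fun j hj => ?_)
  · rw [map_eq_sum_of_support_subset f {i} x (by simpa using hx)]
    simp [hf]
  · by_cases j = i <;> simp_all

end NullSet

theorem nonMeasurableCardinality_nat : NonMeasurableCardinality ℕ := by
  intro U hU
  by_contra! h
  have h1 : ∀ i : ℕ, ({i}ᶜ : Set ℕ) ∈ (U : Filter ℕ) := fun i => by
    rw [Ultrafilter.mem_coe, Ultrafilter.compl_mem_iff_notMem]
    intro hi
    exact h i (Ultrafilter.coe_le_coe.1 (by simpa using hi))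
  have h2 := countable_iInter_mem.2 h1
  have : (⋂ i : ℕ, ({i}ᶜ : Set ℕ)) = ∅ := by ext; simp
  rw [this] at h2
  exact U.empty_notMem h2

/-! ### Finite support and the identification of H -/

section FiniteSupport

variable {I : Type u} [DecidableEq I]

theorem NonMeasurableCardinality.map_eq_sum (hI : NonMeasurableCardinality I) (f : (I → ℤ) →+ ℤ)
    (s : Finset I) (hs : ∀ i ∉ s, f (Pi.single i 1) = 0) (x : I → ℤ) :
    f x = ∑ i ∈ s, x i * f (Pi.single i 1) := by
  let f' : (I → ℤ) →+ ℤ :=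
    f - ∑ i ∈ s, (AddMonoidHom.mulRight (f (Pi.single i 1))).comp (Pi.evalAddMonoidHom _ i)
  have h : f' = 0 := hI.eq_zero_of_map_single_eq_zero fun i => by
    by_cases hi : i ∈ s
    · simp [f', Pi.single_apply, hi]
    · simp [f', Pi.single_apply, hi, hs i hi]
  have := DFunLike.congr_fun h x
  simpa [f', sub_eq_zero] using this

theorem NonMeasurableCardinality.exists_finset (hI : NonMeasurableCardinality I)
    (f : (I → ℤ) →+ ℤ) : ∃ s : Finset I, ∀ x, f x = ∑ i ∈ s, x i * f (Pi.single i 1) :=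
  ⟨(finite_setOf_map_single_ne_zero f).toFinset, hI.map_eq_sum f _ fun i hi => by simpa using hi⟩

/-- The canonical pairing identifies `ℤ ^ (I)` with `Hom(ℤ ^ I, ℤ)`. -/
theorem NonMeasurableCardinality.exists_addEquiv {I : Type u} (hI : NonMeasurableCardinality I) :
    ∃ φ : (I →₀ ℤ) ≃+ ZDual (I → ℤ),
      ∀ (g : I →₀ ℤ) (x : I → ℤ), φ g x = g.sum fun i n => n * x i := by
  classical
  let φ : (I →₀ ℤ) →+ ((I → ℤ) →+ ℤ) := Finsupp.liftAddHom fun i =>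
    AddMonoidHom.flip ((AddMonoidHom.mul (R := ℤ)).flip.comp (Pi.evalAddMonoidHom _ i))
  have hφ : ∀ (g : I →₀ ℤ) (x : I → ℤ), φ g x = g.sum fun i n => n * x i := fun g x => by
    simp [φ, Finsupp.liftAddHom_apply, Finsupp.sum]
  have hsingle : ∀ (g : I →₀ ℤ) (i : I), φ g (Pi.single i 1) = g i := fun g i => by
    rw [hφ]
    simp [Finsupp.sum, Pi.single_apply, eq_comm]
  refine ⟨AddEquiv.ofBijective φ ⟨fun g g' h => ?_, fun f => ?_⟩, hφ⟩
  · ext i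
    rw [← hsingle, ← hsingle]
    exact DFunLike.congr_fun h _
  · let f' : (I → ℤ) →+ ℤ := f
    let g : I →₀ ℤ := Finsupp.onFinset (finite_setOf_map_single_ne_zero f').toFinset
      (fun i => f' (Pi.single i 1)) fun i hi => by simpa using hi
    refine ⟨g, ?_⟩
    refine sub_eq_zero.1 (hI.eq_zero_of_map_single_eq_zero (f := φ g - f') fun i => ?_)
    rw [AddMonoidHom.sub_apply, hsingle]
    simp [g]

end FiniteSupport

/-! ### The gliding hump -/

section GlidingHump

/-- Coefficients that dominate all preceding terms of the rows of a triangular array. -/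
def humpCoeff (a : ℕ → ℕ → ℤ) : ℕ → ℤ
  | n => n + ∑ k : Fin n, |humpCoeff a k * a n k|

lemma humpCoeff_eq (a : ℕ → ℕ → ℤ) (n : ℕ) :
    humpCoeff a n = n + ∑ k ∈ Finset.range n, |humpCoeff a k * a n k| := by
  rw [humpCoeff, Finset.sum_range]

/-- The diagonal entry is a nonzero integer, so the diagonal term of row n exceeds the total size of
the earlier terms by at least n. -/
lemma exists_le_abs_map (h : ℕ → (ℕ → ℤ) →+ ℤ) (h0 : ∀ n k, n < k → h n (Pi.single k 1) = 0)
    (h1 : ∀ n, h n (Pi.single n 1) ≠ 0) : ∃ c : ℕ → ℤ, ∀ n : ℕ, (n : ℤ) ≤ |h n c| := by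
  let a : ℕ → ℕ → ℤ := fun n k => h n (Pi.single k 1)
  refine ⟨humpCoeff a, fun n => ?_⟩
  rw [nonMeasurableCardinality_nat.map_eq_sum (h n) (Finset.range (n + 1))
    (fun k hk => h0 n k (by simpa [Nat.succ_le_iff] using hk)), Finset.sum_range_succ]
  have h2 := Finset.abs_sum_le_sum_abs (fun k => humpCoeff a k * a n k) (Finset.range n)
  have h3 := humpCoeff_eq a n
  have h4 : 1 ≤ |a n n| := Int.one_le_abs (h1 n)
  have h5 : 0 ≤ humpCoeff a n := by rw [h3]; positivity
  have h6 : humpCoeff a n ≤ |humpCoeff a n * a n n| := by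
    rw [abs_mul, abs_of_nonneg h5]
    exact le_mul_of_one_le_right h5 h4
  have h7 := abs_add_le (∑ k ∈ Finset.range n, humpCoeff a k * a n k + humpCoeff a n * a n n)
    (- ∑ k ∈ Finset.range n, humpCoeff a k * a n k)
  rw [add_comm _ (humpCoeff a n * a n n), add_neg_cancel_right, abs_neg] at h7
  rw [add_comm]
  change _ ≤ |humpCoeff a n * a n n + ∑ k ∈ Finset.range n, humpCoeff a k * a n k|
  linarith

/-- A pointwise bounded set of homomorphisms `ℤ ^ I → ℤ` is carried by finitely many coordinates. -/
theorem finite_iUnion_support_of_bounded {I : Type u} [DecidableEq I] (K : Set ((I → ℤ) →+ ℤ))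
    (hK : ∀ x, ∃ N : ℕ, ∀ f ∈ K, |f x| ≤ N) : {i | ∃ f ∈ K, f (Pi.single i 1) ≠ 0}.Finite := by
  classical
  by_contra hinf
  -- Finitely many homomorphisms use only finitely many coordinates, so a new coordinate outside
  -- their supports is always available: this makes the array triangular.
  obtain ⟨s, hs, hlt⟩ := exists_seq_of_forall_finset_exists
    (fun q : ((I → ℤ) →+ ℤ) × I => q.1 ∈ K ∧ q.1 (Pi.single q.2 1) ≠ 0)
    (fun q r => q.1 (Pi.single r.2 1) = 0) (fun t _ => by
      obtain ⟨i, ⟨f, hf, hfi⟩, hi⟩ := Set.Infinite.exists_notMem_finset hinf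
        (t.biUnion fun q => (finite_setOf_map_single_ne_zero q.1).toFinset)
      refine ⟨(f, i), ⟨hf, hfi⟩, fun q hq => ?_⟩
      by_contra hne
      exact hi (Finset.mem_biUnion.2 ⟨q, hq, by simpa using hne⟩))
  have hj : Function.Injective fun n => (s n).2 := by
    intro m n hmn
    rcases lt_trichotomy m n with h | h | h
    · exact absurd (hlt m n h) (by rw [← show (s m).2 = (s n).2 from hmn]; exact (hs m).2)
    · exact h
    · exact absurd (hlt n m h) (by rw [show (s m).2 = (s n).2 from hmn]; exact (hs n).2)
  let x : I → ℤ := fun i => if i ∈ Set.range fun n => (s n).2 then 1 else 0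
  let β := blockHom (Function.invFun fun n => (s n).2) x
  have hβ : ∀ k, β (Pi.single k 1) = Pi.single (s k).2 1 := fun k => by
    ext i
    by_cases hi : ∃ m, (s m).2 = i
    · obtain ⟨m, rfl⟩ := hi
      have := Function.leftInverse_invFun hj m
      simp [β, x, this, Pi.single_apply, hj.eq_iff]
    · have : i ≠ (s k).2 := fun h => hi ⟨k, h.symm⟩
      simp [β, x, hi, this]
  obtain ⟨c, hc⟩ := exists_le_abs_map (fun n => (s n).1.comp β)
    (fun n k hnk => by simpa [hβ] using hlt n k hnk) (fun n => by simpa [hβ] using (hs n).2)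
  obtain ⟨N, hN⟩ := hK (β c)
  have h1 := hc (N + 1)
  have h2 := hN _ (hs (N + 1)).1
  rw [AddMonoidHom.comp_apply] at h1
  push_cast at h1
  omega

end GlidingHump

/-! ### Compact subsets of H and the topology of its dual -/

section ZDual

variable {A : Type u} [AddCommGroup A]

instance : AddMonoidHomClass (ZDual A) A ℤ :=
  inferInstanceAs (AddMonoidHomClass (A →+ ℤ) A ℤ)

@[simp]
lemma ZDual.add_apply (g h : ZDual A) (a : A) : (g + h) a = g a + h a := rfl

@[simp]
lemma ZDual.zero_apply (a : A) : (0 : ZDual A) a = 0 := rfl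

lemma ZDual.continuous_eval (a : A) : Continuous fun g : ZDual A => g a :=
  (continuous_apply a).comp continuous_induced_dom

lemma ZDual.exists_finset_of_mem_nhds_zero {U : Set (ZDual A)} (hU : U ∈ 𝓝 0) :
    ∃ S : Finset A, ∀ g : ZDual A, (∀ a ∈ S, g a = 0) → g ∈ U := by
  rw [nhds_induced, Filter.mem_comap] at hU
  obtain ⟨V, hV, hVU⟩ := hU
  rw [nhds_pi, Filter.mem_pi] at hV
  obtain ⟨S, hS, t, ht, htV⟩ := hV
  refine ⟨hS.toFinset, fun g hg => hVU (htV fun a ha => ?_)⟩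
  change g a ∈ t a
  rw [hg a (by simpa using ha)]
  exact mem_of_mem_nhds (ht a)

/-- Compact sets of homomorphisms `ℤ ^ I → ℤ` are finite. -/
theorem NonMeasurableCardinality.finite_of_isCompact {I : Type u}
    (hI : NonMeasurableCardinality I) {K : Set (ZDual (I → ℤ))} (hK : IsCompact K) : K.Finite := by
  classical
  have hfin : ∀ x : I → ℤ, ((fun g : ZDual (I → ℤ) => g x) '' K).Finite := fun x =>
    (hK.image (ZDual.continuous_eval x)).finite_of_discrete
  let F := {i | ∃ f ∈ K, f (Pi.single i 1) ≠ 0}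
  have hF : F.Finite := finite_iUnion_support_of_bounded K fun x => by
    obtain ⟨N, hN⟩ := ((hfin x).image Int.natAbs).bddAbove
    refine ⟨N, fun f hf => ?_⟩
    have : (f x).natAbs ≤ N := hN ⟨_, ⟨f, hf, rfl⟩, rfl⟩
    rw [Int.abs_eq_natAbs]
    exact_mod_cast this
  have := hF.to_subtype
  -- An element of `K` is determined by its values at the unit vectors from `F`, each taking
  -- finitely many values on `K`.
  refine Set.Finite.of_finite_image (f := fun (g : ZDual (I → ℤ)) (i : F) => g (Pi.single (i : I) 1))
    ((Set.Finite.pi' fun i : F => hfin (Pi.single (i : I) 1)).subset ?_) fun g hg h hh hgh => ?_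
  · rintro _ ⟨g, hg, rfl⟩ i
    exact ⟨g, hg, rfl⟩
  · refine sub_eq_zero.1 (hI.eq_zero_of_map_single_eq_zero
      (f := (show (I → ℤ) →+ ℤ from g) - (show (I → ℤ) →+ ℤ from h)) fun i => ?_)
    change g (Pi.single i 1) - h (Pi.single i 1) = 0
    by_cases hi : i ∈ F
    · exact sub_eq_zero.2 (congrFun hgh ⟨i, hi⟩)
    · have : ∀ f ∈ K, f (Pi.single i 1) = 0 := fun f hf => by
        by_contra hne; exact hi ⟨f, hf, hne⟩
      rw [this g hg, this h hh, sub_zero]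

/-- Characters of a group without infinite compact subsets carry the topology of pointwise
convergence. -/
theorem CharGroup.isInducing_coe {H : Type v} [AddCommGroup H] [TopologicalSpace H]
    (hH : ∀ K : Set H, IsCompact K → K.Finite) :
    Topology.IsInducing fun (χ : CharGroup H) (g : H) => χ g := by
  have h : Topology.IsInducing fun (f : C(H, Torus)) (g : H) => f g := by
    refine ⟨le_antisymm (continuous_pi fun g => continuous_eval_const g).le_induced ?_⟩
    refine le_generateFrom ?_
    rintro _ ⟨K, hK, U, hU, rfl⟩
    refine ⟨{f | ∀ g ∈ K, f g ∈ U}, isOpen_set_pi (hH K hK) fun _ _ => hU, rfl⟩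
  exact h.comp (ContinuousAddMonoidHom.isInducing_toContinuousMap H Torus)

end ZDual

/-! ### The torus and quasi-convex neighbourhoods -/

section Torus

lemma Torus.norm_two_nsmul {t : Torus} (ht : ‖t‖ ≤ 1 / 4) : ‖2 • t‖ = 2 * ‖t‖ := by
  induction t using QuotientAddGroup.induction_on with
  | H x =>
    have h1 : ‖(x : UnitAddCircle)‖ = |x - round x| := UnitAddCircle.norm_eq
    have h2 : ((x - round x : ℝ) : UnitAddCircle) = (x : UnitAddCircle) := by
      rw [AddCircle.coe_sub]
      have : ((round x : ℝ) : UnitAddCircle) = 0 :=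
        (AddCircle.coe_eq_zero_iff 1).2 ⟨round x, by simp⟩
      rw [this, sub_zero]
    change ‖(x : UnitAddCircle)‖ ≤ _ at ht
    change ‖2 • (x : UnitAddCircle)‖ = 2 * ‖(x : UnitAddCircle)‖
    rw [h1] at ht ⊢
    rw [← h2, ← AddCircle.coe_nsmul, (AddCircle.norm_coe_eq_abs_iff 1 one_ne_zero).2, nsmul_eq_mul,
      abs_mul]
    · simp
    · rw [nsmul_eq_mul, abs_mul]
      norm_num
      linarith

/-- As long as the norm is at most 1/4, doubling is exact. Hence finitely many conditions with the
fixed bound 1/4 cut out arbitrarily small balls. -/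
lemma Torus.norm_two_pow_nsmul {t : Torus} {n : ℕ} (h : ∀ k ≤ n, ‖2 ^ k • t‖ ≤ 1 / 4) :
    2 ^ n * ‖t‖ ≤ 1 / 4 := by
  have : ∀ k ≤ n, ‖2 ^ k • t‖ = 2 ^ k * ‖t‖ := fun k => by
    induction k with
    | zero => simp
    | succ k ih =>
      intro hk
      rw [pow_succ', mul_nsmul', Torus.norm_two_nsmul (h k (by omega)), ih (by omega), pow_succ']
      ring
  rw [← this n le_rfl]
  exact h n le_rfl

/-- The torus has no small subgroups. -/
lemma Torus.eq_zero_of_forall_nsmul {t : Torus} (h : ∀ n : ℕ, ‖n • t‖ ≤ 1 / 4) : t = 0 := by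
  by_contra hne
  have hpos : 0 < ‖t‖ := norm_pos_iff.2 hne
  obtain ⟨n, hn⟩ := pow_unbounded_of_one_lt (1 / ‖t‖) (one_lt_two (α := ℝ))
  have := Torus.norm_two_pow_nsmul (t := t) (n := n) fun k _ => h _
  rw [div_lt_iff₀ hpos] at hn
  linarith

/-- Every neighbourhood of `0` generates the torus. -/
lemma Torus.exists_nsmul_eq {W : Set Torus} (hW : W ∈ 𝓝 0) (t : Torus) :
    ∃ (n : ℕ), ∃ s ∈ W, n • s = t := by
  induction t using QuotientAddGroup.induction_on with
  | H x =>
    have hc : Filter.Tendsto (fun n : ℕ => ((x / n : ℝ) : Torus)) Filter.atTop (𝓝 0) := by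
      have h1 : Filter.Tendsto (fun n : ℕ => x / n) Filter.atTop (𝓝 0) :=
        tendsto_const_div_atTop_nhds_zero_nat x
      have h2 : Continuous fun y : ℝ => (y : Torus) := AddCircle.continuous_mk' 1
      simpa [Function.comp_def] using (h2.tendsto 0).comp h1
    obtain ⟨n, hn, hn0⟩ := ((hc.eventually hW).and (Filter.eventually_gt_atTop 0)).exists
    refine ⟨n, _, hn, ?_⟩
    rw [← AddCircle.coe_nsmul, nsmul_eq_mul, mul_div_cancel₀ x (Nat.cast_ne_zero.2 hn0.ne')]

lemma subset_prepolar_polar {G : Type u} [AddCommGroup G] [TopologicalSpace G] (A : Set G) :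
    A ⊆ prepolar (polar A) := fun a ha _ hχ => hχ a ha

lemma quasiConvex_prepolar {G : Type u} [AddCommGroup G] [TopologicalSpace G]
    (X : Set (CharGroup G)) : QuasiConvex (prepolar X) :=
  Set.Subset.antisymm (fun _ hg χ hχ => hg χ fun _ ha => ha χ hχ) (subset_prepolar_polar _)

/-- A group topology induced by homomorphisms into the torus is locally quasi-convex. -/
theorem locallyQuasiConvex_of_isInducing {G : Type u} [AddCommGroup G] [TopologicalSpace G]
    {ι : Type v} (ρ : ι → G →+ Torus) (h : Topology.IsInducing fun x j => ρ j x) :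
    LocallyQuasiConvex G := by
  intro U hU
  rw [h.nhds_eq_comap, Filter.mem_comap] at hU
  obtain ⟨V, hV, hVU⟩ := hU
  rw [nhds_pi, Filter.mem_pi] at hV
  obtain ⟨S, hS, t, ht, htV⟩ := hV
  have hε : ∃ n : ℕ, ∀ j ∈ S, ∀ s : Torus, 2 ^ n * ‖s‖ ≤ 1 / 4 → s ∈ t j := by
    have : ∀ j, ∃ n : ℕ, ∀ s : Torus, 2 ^ n * ‖s‖ ≤ 1 / 4 → s ∈ t j := fun j => by
      have := ht j
      rw [map_zero, Metric.mem_nhds_iff] at this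
      obtain ⟨ε, hε, hball⟩ := this
      obtain ⟨n, hn⟩ := pow_unbounded_of_one_lt (1 / ε) (one_lt_two (α := ℝ))
      refine ⟨n, fun s hs => hball ?_⟩
      rw [mem_ball_zero_iff]
      rw [div_lt_iff₀ hε] at hn
      by_contra! hle
      have := mul_le_mul_of_nonneg_left hle (pow_nonneg (zero_le_two (α := ℝ)) n)
      linarith
    choose n hn using this
    refine ⟨hS.toFinset.sup n, fun j hj s hs => hn j s (le_trans ?_ hs)⟩
    gcongr
    · norm_num
    · exact Finset.le_sup (f := n) (by simpa using hj)
  obtain ⟨n, hn⟩ := hε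
  have hρ : ∀ j, Continuous (ρ j) := fun j => (continuous_apply j).comp h.continuous
  let c : ι → ℕ → CharGroup G := fun j k => ⟨2 ^ k • ρ j, (hρ j).const_smul (2 ^ k)⟩
  have hc : ∀ j k x, c j k x = 2 ^ k • ρ j x := fun j k x => rfl
  refine ⟨prepolar {χ | ∃ j ∈ S, ∃ k ≤ n, χ = c j k}, ?_, quasiConvex_prepolar _, fun x hx => ?_⟩
  · have h1 : ∀ j ∈ S, ∀ k ∈ Set.Iic n, ∀ᶠ x in 𝓝 (0 : G), ‖c j k x‖ ≤ 1 / 4 := fun j _ k _ => by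
      have h2 : Filter.Tendsto (fun x => ‖c j k x‖) (𝓝 0) (𝓝 0) := by
        have := ((c j k).continuous_toFun.norm).tendsto 0
        simpa using this
      exact h2.eventually (ge_mem_nhds (by norm_num))
    have h3 := (Filter.eventually_all_finite hS).2 fun j hj =>
      (Filter.eventually_all_finite (Set.finite_Iic n)).2 (h1 j hj)
    filter_upwards [h3] with x hx
    rintro _ ⟨j, hj, k, hk, rfl⟩
    exact hx j hj k hk
  · refine hVU (htV fun j hj => hn j hj _ (Torus.norm_two_pow_nsmul fun k hk => ?_))
    rw [← hc]
    exact hx _ ⟨j, hj, k, hk, rfl⟩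

end Torus

/-! ### Characters of H as tensors -/

section TensorLift

variable {G : Type*} {H : Type*} {B : Type*} [AddCommGroup G] [AddCommGroup H] [AddCommGroup B]

/-- The homomorphism on the algebraic tensor product defined by a biadditive map. -/
def tensorLift (b : G → H → B) (hl : ∀ x x' y, b (x + x') y = b x y + b x' y)
    (hr : ∀ x y y', b x (y + y') = b x y + b x y') : G ⊗[ℤ] H →+ B :=
  TensorProduct.liftAddHom
    (AddMonoidHom.mk' (fun x => AddMonoidHom.mk' (b x) (hr x)) fun x x' => by ext y; exact hl x x' y)
    fun n x y => by rw [map_zsmul, map_zsmul, AddMonoidHom.smul_apply]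

end TensorLift

section CharTensor

variable {A : Type u} [AddCommGroup A]

/-- The character `g ↦ g a • t` of `Hom(A, ℤ)`. -/
def ZDual.char (a : A) (t : Torus) : CharGroup (ZDual A) where
  toFun g := g a • t
  map_zero' := by simp
  map_add' g h := by simp [add_smul]
  continuous_toFun :=
    (continuous_of_discreteTopology (f := fun n : ℤ => n • t)).comp (ZDual.continuous_eval a)

@[simp]
lemma ZDual.char_apply (a : A) (t : Torus) (g : ZDual A) : ZDual.char a t g = g a • t := rfl

variable (A) in
/-- The canonical homomorphism from `A ⊗ 𝕋` to the characters of `Hom(A, ℤ)`. -/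
def charTensor : A ⊗[ℤ] Torus →+ CharGroup (ZDual A) :=
  tensorLift ZDual.char (fun x x' t => by ext g; simp [add_smul]) fun x t t' => by ext g; simp

@[simp]
lemma charTensor_tmul (a : A) (t : Torus) (g : ZDual A) :
    charTensor A (a ⊗ₜ t) g = g a • t := rfl

/-- Every character of `Hom(A, ℤ)` depends on finitely many values only. -/
theorem charTensor_surjective : Function.Surjective (charTensor A) := by
  classical
  intro χ
  have hU : {g : ZDual A | ‖χ g‖ ≤ 1 / 4} ∈ 𝓝 0 := by
    have h := (χ.continuous_toFun.norm).tendsto 0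
    have h' : Filter.Tendsto (fun g => ‖χ g‖) (𝓝 0) (𝓝 0) := by simpa using h
    exact h'.eventually (ge_mem_nhds (by norm_num))
  obtain ⟨S, hS⟩ := ZDual.exists_finset_of_mem_nhds_zero hU
  let ρ : ZDual A →+ (S → ℤ) :=
    { toFun := fun g a => g (a : A)
      map_zero' := rfl
      map_add' := fun _ _ => rfl }
  -- All multiples of g lie in the kernel, where χ is bounded by 1/4; 𝕋 has no small subgroups.
  have hker : ρ.ker ≤ (χ : ZDual A →+ Torus).ker := fun g hg => by
    refine Torus.eq_zero_of_forall_nsmul fun n => ?_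
    rw [← map_nsmul]
    refine hS _ fun a ha => ?_
    have : ρ (n • g) = 0 := by rw [map_nsmul, AddMonoidHom.mem_ker.1 hg, smul_zero]
    exact congrFun this ⟨a, ha⟩
  let χ' : ρ.range →+ Torus :=
    (QuotientAddGroup.lift _ (χ : ZDual A →+ Torus) hker).comp
      (QuotientAddGroup.quotientKerEquivRange ρ).symm.toAddMonoidHom
  have hχ' : ∀ g, χ' (ρ.rangeRestrict g) = χ g := fun g => by
    have : (QuotientAddGroup.quotientKerEquivRange ρ).symm (ρ.rangeRestrict g)
        = QuotientAddGroup.mk g := by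
      rw [AddEquiv.symm_apply_eq]
      rfl
    change QuotientAddGroup.lift _ (χ : ZDual A →+ Torus) hker
      ((QuotientAddGroup.quotientKerEquivRange ρ).symm (ρ.rangeRestrict g)) = _
    rw [this]
    rfl
  obtain ⟨ψ, hψ⟩ := (Module.Baer.of_divisible Torus).extension_property_addMonoidHom
    ρ.range.subtype Subtype.val_injective χ'
  refine ⟨∑ a : S, (a : A) ⊗ₜ ψ (Pi.single a 1), ?_⟩
  ext g
  have h1 : ψ (ρ g) = χ g := by
    rw [← hχ', ← hψ]
    rfl
  have h2 : ρ g = ∑ a : S, g (a : A) • (Pi.single a 1 : S → ℤ) := by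
    ext a
    change g (a : A) = _
    simp [Finset.sum_apply, Pi.single_apply]
  have h3 : ∀ s : Finset S, (charTensor A (∑ a ∈ s, (a : A) ⊗ₜ ψ (Pi.single a 1))) g
      = ∑ a ∈ s, g (a : A) • ψ (Pi.single a 1) := fun s => by
    induction s using Finset.induction_on with
    | empty => simp
    | insert a s ha ih =>
      rw [Finset.sum_insert ha, Finset.sum_insert ha, map_add, ContinuousAddMonoidHom.add_apply, ih,
        charTensor_tmul]
  rw [h3, ← h1, h2, map_sum]
  simp only [map_zsmul]

end CharTensor

/-! ### Bihomomorphisms and finitely many coordinates -/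

section Lift

variable {I : Type u}

/-- The `i`-th coordinate as an element of `Hom(ℤ ^ I, ℤ)`. -/
def ZDual.coord (i : I) : ZDual (I → ℤ) := Pi.evalAddMonoidHom _ i

/-- Continuous bihomomorphisms on `ℤ ^ I × 𝕋` into locally quasi-convex groups depend on finitely
many coordinates of `ℤ ^ I`, up to a prescribed neighbourhood of `0`. -/
theorem IsContBihom.exists_finset_of_mem_nhds_zero {B : Type w} [AddCommGroup B]
    [TopologicalSpace B] [IsTopologicalAddGroup B] (hB : LocallyQuasiConvex B)
    {b : (I → ℤ) → Torus → B} (hb : IsContBihom b) {U : Set B} (hU : U ∈ 𝓝 0) :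
    ∃ F : Finset I, ∃ W ∈ 𝓝 (0 : Torus), ∀ u : (I → ℤ) ⊗[ℤ] Torus,
      (∀ i ∈ F, charTensor _ u (ZDual.coord i) ∈ W) →
        tensorLift b hb.map_add_left hb.map_add_right u ∈ U := by
  classical
  obtain ⟨V, hV, hVq, hVU⟩ := hB U hU
  have h00 : b 0 0 = 0 := by simpa using hb.map_add_left 0 0 0
  have hn : ∀ (n : ℕ) x t, b (n • x) t = n • b x t := fun n x t =>
    (AddMonoidHom.mk' (fun x => b x t) fun x x' => hb.map_add_left x x' t).map_nsmul n x |>.symm ▸ rfl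
  have hnr : ∀ (n : ℕ) x t, b x (n • t) = n • b x t := fun n x t =>
    (AddMonoidHom.mk' (b x) (hb.map_add_right x)).map_nsmul n t |>.symm ▸ rfl
  obtain ⟨P, hP, Q, hQ, hPQ⟩ : ∃ P ∈ 𝓝 (0 : I → ℤ), ∃ Q ∈ 𝓝 (0 : Torus),
      ∀ x ∈ P, ∀ t ∈ Q, b x t ∈ V := by
    have h := hb.continuousAt_zero
    have h' : (fun p : (I → ℤ) × Torus => b p.1 p.2) ⁻¹' V ∈ 𝓝 (0, 0) :=
      h (by simpa only [h00] using hV)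
    rw [mem_nhds_prod_iff] at h'
    obtain ⟨P, hP, Q, hQ, hPQ⟩ := h'
    exact ⟨P, hP, Q, hQ, fun x hx t ht => hPQ (Set.mk_mem_prod hx ht)⟩
  rw [nhds_pi, Filter.mem_pi] at hP
  obtain ⟨S, hS, s, hs, hsP⟩ := hP
  have hSP : ∀ x : I → ℤ, (∀ i ∈ S, x i = 0) → x ∈ P := fun x hx => hsP fun i hi => by
    rw [hx i hi]; exact mem_of_mem_nhds (hs i)
  -- For q in `Q` all multiples of x stay in `P`, so the multiples of χ(b(x, q)) stay within 1/4 and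
  -- it is 0. Every t is a multiple of such a q.
  have hvan : ∀ χ ∈ polar V, ∀ x : I → ℤ, (∀ i ∈ S, x i = 0) → ∀ t, χ (b x t) = 0 := by
    intro χ hχ x hx t
    obtain ⟨m, q, hq, rfl⟩ := Torus.exists_nsmul_eq hQ t
    rw [hnr, map_nsmul, Torus.eq_zero_of_forall_nsmul (t := χ (b x q)) fun n => ?_, smul_zero]
    rw [← map_nsmul, ← hn]
    exact hχ _ (hPQ _ (hSP _ fun i hi => by simp [hx i hi]) _ hq)
  let F := hS.toFinset
  let L := tensorLift b hb.map_add_left hb.map_add_right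
  have hsum : ∀ χ ∈ polar V, ∀ u : (I → ℤ) ⊗[ℤ] Torus,
      χ (L u) = χ (∑ i ∈ F, b (Pi.single i 1) (charTensor _ u (ZDual.coord i))) := by
    intro χ hχ u
    induction u using TensorProduct.induction_on with
    | zero =>
      have : ∀ x, b x 0 = 0 := fun x => by simpa using hb.map_add_right x 0 0
      simp [this]
    | add u v hu hv =>
      simp only [map_add, ContinuousAddMonoidHom.add_apply, hb.map_add_right,
        Finset.sum_add_distrib, hu, hv]
    | tmul x t =>
      let y : I → ℤ := ∑ i ∈ F, x i • Pi.single i 1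
      have hy : ∀ i ∈ S, (x - y) i = 0 := fun i hi => by
        simp [y, Finset.sum_apply, Pi.single_apply, F, hi]
      have h1 : L (x ⊗ₜ t) = L ((x - y) ⊗ₜ t) + L (y ⊗ₜ t) := by
        rw [← map_add, ← TensorProduct.add_tmul, sub_add_cancel]
      have h2 : χ (L ((x - y) ⊗ₜ t)) = 0 := hvan χ hχ _ hy t
      rw [h1, map_add, h2, zero_add]
      simp only [y, TensorProduct.sum_tmul, map_sum, TensorProduct.smul_tmul]
      rfl
  have hcont : ContinuousAt
      (fun z : I → Torus => ∑ i ∈ F, b (Pi.single i 1) (z i)) 0 :=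
    (continuous_finsetSum F fun i _ =>
      (hb.continuous_right (Pi.single i 1)).comp (continuous_apply i)).continuousAt
  have hb0 : ∀ x, b x 0 = 0 := fun x => by simpa using hb.map_add_right x 0 0
  have hV' := hcont (show V ∈ 𝓝 _ by simpa [hb0] using hV)
  rw [Filter.mem_map, nhds_pi, Filter.mem_pi] at hV'
  obtain ⟨R, hR, r, hr, hrV⟩ := hV'
  refine ⟨F, ⋂ i ∈ hR.toFinset, r i, (Filter.biInter_finset_mem _).2 fun i _ => hr i,
    fun u hu => hVU ?_⟩
  -- Membership in V is tested on its polar, where `L u` may be replaced by the finite sum, which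
  -- lies in V itself.
  rw [← hVq]
  intro χ hχ
  change ‖χ (L u)‖ ≤ 1 / 4
  rw [hsum χ hχ]
  refine hχ _ ?_
  let z : I → Torus := fun i => if i ∈ F then charTensor _ u (ZDual.coord i) else 0
  have hz : z ∈ R.pi r := fun i hi => by
    by_cases hF : i ∈ F
    · simp only [z, hF, if_true]
      exact Set.mem_iInter₂.1 (hu i hF) i (by simpa using hi)
    · simp only [z, hF, if_false]
      exact mem_of_mem_nhds (hr i)
  have := hrV hz
  have h3 : ∑ i ∈ F, b (Pi.single i 1) (z i)
      = ∑ i ∈ F, b (Pi.single i 1) (charTensor _ u (ZDual.coord i)) :=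
    Finset.sum_congr rfl fun i hi => by simp [z, hi]
  rw [← h3]
  exact this

variable (I) in
/-- The topology on `ℤ ^ I ⊗ 𝕋` of pointwise convergence on `Hom(ℤ ^ I, ℤ)`. -/
@[reducible]
def pointwiseTopology : TopologicalSpace ((I → ℤ) ⊗[ℤ] Torus) :=
  TopologicalSpace.induced (fun u (g : ZDual (I → ℤ)) => charTensor _ u g) inferInstance

variable (I) in
lemma isTopologicalAddGroup_pointwiseTopology :
    @IsTopologicalAddGroup _ (pointwiseTopology I) _ :=
  topologicalAddGroup_induced (AddMonoidHom.mk'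
    (fun (u : (I → ℤ) ⊗[ℤ] Torus) (g : ZDual (I → ℤ)) => charTensor _ u g)
    fun u v => by ext g; simp)

theorem IsContBihom.continuous_tensorLift {B : Type w} [AddCommGroup B]
    [TopologicalSpace B] [IsTopologicalAddGroup B] (hB : LocallyQuasiConvex B)
    {b : (I → ℤ) → Torus → B} (hb : IsContBihom b) :
    @Continuous _ _ (pointwiseTopology I) _ (tensorLift b hb.map_add_left hb.map_add_right) := by
  let _ := pointwiseTopology I
  have := isTopologicalAddGroup_pointwiseTopology I
  refine continuous_of_continuousAt_zero _ ?_
  rw [ContinuousAt, map_zero]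
  intro U hU
  obtain ⟨F, W, hW, h⟩ := hb.exists_finset_of_mem_nhds_zero hB hU
  have hc : ∀ i, Filter.Tendsto (fun u => charTensor (I → ℤ) u (ZDual.coord i)) (𝓝 0) (𝓝 0) :=
    fun i => by
      have : Continuous fun u => charTensor (I → ℤ) u (ZDual.coord i) :=
        (continuous_apply (ZDual.coord i)).comp continuous_induced_dom
      simpa using this.tendsto 0
  rw [Filter.mem_map]
  filter_upwards [(Filter.eventually_all_finset F).2 fun i _ => (hc i).eventually hW] with u hu
  exact h u hu

end Lift

/-! ### The finest admissible topology -/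

section Topology

variable {I : Type u}

/-- Finite support makes g continuous into discrete ℤ, and ℤ × 𝕋 → 𝕋 is jointly continuous. -/
lemma NonMeasurableCardinality.continuous_pairing (hI : NonMeasurableCardinality I)
    (g : ZDual (I → ℤ)) : Continuous fun p : (I → ℤ) × Torus => g p.1 • p.2 := by
  classical
  obtain ⟨s, hs⟩ := hI.exists_finset g
  have h1 : Continuous fun x : I → ℤ => g x := by
    have : (fun x : I → ℤ => g x) = fun x => ∑ i ∈ s, x i * g (Pi.single i 1) := funext hs
    rw [this]
    fun_prop
  have h2 : Continuous fun q : ℤ × Torus => q.1 • q.2 :=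
    continuous_prod_of_discrete_left.2 fun n => continuous_zsmul n
  exact h2.comp ((h1.comp continuous_fst).prodMk continuous_snd)

lemma NonMeasurableCardinality.isContBihom_of_isInducing (hI : NonMeasurableCardinality I)
    {T : Type v} [AddCommGroup T] [TopologicalSpace T] (ρ : T → ZDual (I → ℤ) → Torus)
    (hρ : Topology.IsInducing ρ) (τ : (I → ℤ) → Torus → T)
    (hl : ∀ x x' t, τ (x + x') t = τ x t + τ x' t) (hr : ∀ x t t', τ x (t + t') = τ x t + τ x t')
    (h : ∀ x t g, ρ (τ x t) g = g x • t) : IsContBihom τ := by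
  have hc : Continuous fun p : (I → ℤ) × Torus => τ p.1 p.2 :=
    hρ.continuous_iff.2 (continuous_pi fun g => by
      simpa only [Function.comp_def, h] using hI.continuous_pairing g)
  exact ⟨hl, hr, fun t => hc.comp (continuous_id.prodMk continuous_const),
    fun x => hc.comp (continuous_const.prodMk continuous_id), hc.continuousAt⟩

theorem NonMeasurableCardinality.pointwiseTopology_mem (hI : NonMeasurableCardinality I) :
    pointwiseTopology I ∈ admissibleTopologies (I → ℤ) Torus := by
  let _ := pointwiseTopology I
  have hind : Topology.IsInducing
    fun (u : (I → ℤ) ⊗[ℤ] Torus) (g : ZDual (I → ℤ)) => charTensor _ u g := ⟨rfl⟩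
  refine ⟨isTopologicalAddGroup_pointwiseTopology I, ?_, ?_⟩
  · exact locallyQuasiConvex_of_isInducing (fun g : ZDual (I → ℤ) => AddMonoidHom.mk'
      (fun u => charTensor (I → ℤ) u g) fun u v => by simp) hind
  · exact hI.isContBihom_of_isInducing _ hind _ (fun x x' t => TensorProduct.add_tmul x x' t)
      (fun x t t' => TensorProduct.tmul_add x t t') fun _ _ _ => rfl

/-- The identity is the lift of the tensor map itself, a continuous bihomomorphism for t; t need not
be Hausdorff. -/
theorem pointwiseTopology_le {t : TopologicalSpace ((I → ℤ) ⊗[ℤ] Torus)}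
    (ht : t ∈ admissibleTopologies (I → ℤ) Torus) : pointwiseTopology I ≤ t := by
  obtain ⟨h1, h2, h3⟩ := ht
  have h := h3.continuous_tensorLift h2
  rw [← @continuous_id_iff_le]
  convert h using 1
  ext u
  induction u using TensorProduct.induction_on with
  | zero => exact (map_zero _).symm
  | tmul x t => rfl
  | add u v hu hv =>
    rw [map_add, ← hu, ← hv]
    rfl

theorem NonMeasurableCardinality.topology_eq (hI : NonMeasurableCardinality I) :
    (inferInstance : TopologicalSpace (PreLQTensor (I → ℤ) Torus)) = pointwiseTopology I :=
  le_antisymm (sInf_le hI.pointwiseTopology_mem) (le_sInf fun _ ht => pointwiseTopology_le ht)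

theorem NonMeasurableCardinality.isInducing_charTensor (hI : NonMeasurableCardinality I) :
    Topology.IsInducing fun u : PreLQTensor (I → ℤ) Torus => charTensor (I → ℤ) u :=
  (CharGroup.isInducing_coe fun _ => hI.finite_of_isCompact).of_comp_iff.1 ⟨hI.topology_eq⟩

end Topology

/-! ### The Hausdorff quotient and the universal property -/

section LQTensor

variable {I : Type u}

lemma LQTensor.induction_on {G : Type u} {H : Type v} [AddCommGroup G] [TopologicalSpace G]
    [AddCommGroup H] [TopologicalSpace H] {motive : LQTensor G H → Prop} (z : LQTensor G H)
    (zero : motive 0) (tmul : ∀ x y, motive (LQTensor.tmul x y))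
    (add : ∀ z w, motive z → motive w → motive (z + w)) : motive z := by
  obtain ⟨u, rfl⟩ := SeparationQuotient.surjective_mk z
  exact TensorProduct.induction_on (motive := fun u : G ⊗[ℤ] H =>
    motive (SeparationQuotient.mk (show PreLQTensor G H from u))) u zero tmul
    fun u v hu hv => add _ _ hu hv

lemma LQTensor.tmul_add_left {G : Type u} {H : Type v} [AddCommGroup G] [TopologicalSpace G]
    [AddCommGroup H] [TopologicalSpace H] (x x' : G) (y : H) :
    LQTensor.tmul (x + x') y = LQTensor.tmul x y + LQTensor.tmul x' y :=
  congrArg (SeparationQuotient.mk (X := PreLQTensor G H)) (TensorProduct.add_tmul x x' y)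

lemma LQTensor.tmul_add_right {G : Type u} {H : Type v} [AddCommGroup G] [TopologicalSpace G]
    [AddCommGroup H] [TopologicalSpace H] (x : G) (y y' : H) :
    LQTensor.tmul x (y + y') = LQTensor.tmul x y + LQTensor.tmul x y' :=
  congrArg (SeparationQuotient.mk (X := PreLQTensor G H)) (TensorProduct.tmul_add x y y')

lemma isInducing_separationQuotient_lift {X : Type u} {Y : Type v} [TopologicalSpace X]
    [TopologicalSpace Y] {f : X → Y} (hf : Topology.IsInducing f)
    (h : ∀ x y, Inseparable x y → f x = f y) :
    Topology.IsInducing (SeparationQuotient.lift f h) := by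
  refine Topology.isInducing_iff_nhds.2 fun z => ?_
  obtain ⟨u, rfl⟩ := SeparationQuotient.surjective_mk z
  rw [← SeparationQuotient.map_mk_nhds, hf.nhds_eq_comap]
  change Filter.map _ (Filter.comap (SeparationQuotient.lift f h ∘ SeparationQuotient.mk) _) = _
  rw [← Filter.comap_comap, Filter.map_comap_of_surjective SeparationQuotient.surjective_mk]
  rfl

instance {G : Type u} {H : Type v} [AddCommGroup G] [TopologicalSpace G]
    [AddCommGroup H] [TopologicalSpace H] : T0Space (LQTensor G H) :=
  inferInstanceAs (T0Space (SeparationQuotient (PreLQTensor G H)))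

theorem NonMeasurableCardinality.exists_charGroup_equiv (hI : NonMeasurableCardinality I) :
    ∃ e : CharGroup (ZDual (I → ℤ)) ≃ₜ+ LQTensor (I → ℤ) Torus,
      ∀ (x : I → ℤ) (t : Torus) (g : ZDual (I → ℤ)),
        e.symm (LQTensor.tmul x t) g = g x • t := by
  have hind := hI.isInducing_charTensor
  let Φ : LQTensor (I → ℤ) Torus → CharGroup (ZDual (I → ℤ)) :=
    SeparationQuotient.lift (fun u : PreLQTensor (I → ℤ) Torus => charTensor (I → ℤ) u)
      fun u v h => (h.map hind.continuous).eq
  have hΦ : Topology.IsInducing Φ := isInducing_separationQuotient_lift hind _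
  have hadd : ∀ z w, Φ (z + w) = Φ z + Φ w := fun z w => by
    obtain ⟨u, rfl⟩ := SeparationQuotient.surjective_mk z
    obtain ⟨v, rfl⟩ := SeparationQuotient.surjective_mk w
    exact map_add (charTensor (I → ℤ)) u v
  have hbij : Function.Bijective Φ := by
    -- Injectivity is automatic for an inducing map on a T0 space.
    refine ⟨hΦ.injective, fun χ => ?_⟩
    obtain ⟨u, hu⟩ := charTensor_surjective χ
    exact ⟨SeparationQuotient.mk (show PreLQTensor (I → ℤ) Torus from u), hu⟩
  let h := (Equiv.ofBijective Φ hbij).toHomeomorphOfIsInducing hΦ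
  let e : LQTensor (I → ℤ) Torus ≃ₜ+ CharGroup (ZDual (I → ℤ)) := { h with map_add' := hadd }
  exact ⟨e.symm, fun _ _ _ => rfl⟩

theorem NonMeasurableCardinality.isLQTensorProduct (hI : NonMeasurableCardinality I) :
    IsLQTensorProduct.{w} (LQTensor.tmul : (I → ℤ) → Torus → LQTensor (I → ℤ) Torus) := by
  obtain ⟨e, he⟩ := hI.exists_charGroup_equiv
  have hind : Topology.IsInducing
      fun (z : LQTensor (I → ℤ) Torus) (g : ZDual (I → ℤ)) => e.symm z g :=
    (CharGroup.isInducing_coe fun _ => hI.finite_of_isCompact).comp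
      e.symm.toHomeomorph.isInducing
  refine ⟨⟨inferInstance, ?_, ?_⟩, ?_, ?_, ?_⟩
  · infer_instance
  · exact locallyQuasiConvex_of_isInducing (fun g : ZDual (I → ℤ) => AddMonoidHom.mk'
      (fun z => e.symm z g) fun z w => by simp) hind
  · exact hI.isContBihom_of_isInducing _ hind _ LQTensor.tmul_add_left LQTensor.tmul_add_right he
  · intro B _ _ hB b hb
    have := hB.topologicalGroup
    have := hB.hausdorff
    have hc := hb.continuous_tensorLift hB.locallyQuasiConvex
    rw [← hI.topology_eq] at hc
    let L : PreLQTensor (I → ℤ) Torus → B := tensorLift b hb.map_add_left hb.map_add_right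
    have hL : Continuous L := hc
    let f : LQTensor (I → ℤ) Torus → B := SeparationQuotient.lift L fun u v h => (h.map hL).eq
    have hf : ∀ z w, f (z + w) = f z + f w := fun z w => by
      obtain ⟨u, rfl⟩ := SeparationQuotient.surjective_mk z
      obtain ⟨v, rfl⟩ := SeparationQuotient.surjective_mk w
      exact map_add (tensorLift b hb.map_add_left hb.map_add_right) u v
    exact ⟨⟨AddMonoidHom.mk' f hf, hL.quotient_lift _⟩, fun _ _ => rfl⟩
  · intro B _ h₁ h₂ h
    ext z
    induction z using LQTensor.induction_on with
    | zero => simp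
    | tmul x t => exact h x t
    | add z w hz hw => rw [map_add, map_add, hz, hw]

end LQTensor

/-- For `I` of non-measurable cardinality, `H = Hom(ℤ ^ I, ℤ)` is `ℤ ^ (I)` by the canonical pairing,
and its Pontryagin dual, for the topology of pointwise convergence on `ℤ ^ I`, is topologically
isomorphic to the locally quasi-convex tensor product of `ℤ ^ I` and `𝕋`, by the canonical map;
in particular this holds for `I = ℕ`. -/
theorem theoremA :
    (∀ I : Type u, NonMeasurableCardinality I →
      (∃ φ : (I →₀ ℤ) ≃+ ZDual (I → ℤ),
        ∀ (g : I →₀ ℤ) (x : I → ℤ), φ g x = g.sum fun i n => n * x i) ∧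
      IsLQTensorProduct.{w} (LQTensor.tmul : (I → ℤ) → Torus → LQTensor (I → ℤ) Torus) ∧
      ∃ e : CharGroup (ZDual (I → ℤ)) ≃ₜ+ LQTensor (I → ℤ) Torus,
        ∀ (x : I → ℤ) (t : Torus) (g : ZDual (I → ℤ)),
          e.symm (LQTensor.tmul x t) g = g x • t) ∧
    ((∃ φ : (ℕ →₀ ℤ) ≃+ ZDual (ℕ → ℤ),
        ∀ (g : ℕ →₀ ℤ) (x : ℕ → ℤ), φ g x = g.sum fun i n => n * x i) ∧
      IsLQTensorProduct.{w} (LQTensor.tmul : (ℕ → ℤ) → Torus → LQTensor (ℕ → ℤ) Torus) ∧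
      ∃ e : CharGroup (ZDual (ℕ → ℤ)) ≃ₜ+ LQTensor (ℕ → ℤ) Torus,
        ∀ (x : ℕ → ℤ) (t : Torus) (g : ZDual (ℕ → ℤ)),
          e.symm (LQTensor.tmul x t) g = g x • t) :=
  ⟨fun _ hI => ⟨hI.exists_addEquiv, hI.isLQTensorProduct, hI.exists_charGroup_equiv⟩,
    nonMeasurableCardinality_nat.exists_addEquiv, nonMeasurableCardinality_nat.isLQTensorProduct,
    nonMeasurableCardinality_nat.exists_charGroup_equiv⟩
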